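/- Throughout, $C^*$-algebras are complex and unital, and for a self-adjoint element $X$ with spectrum $\sigma(X)$ and a real function $h$ that is continuous on $\sigma(X)$, $h(X)$ denotes the continuous functional calculus. A function $h\colon(0,\infty)\to\mathbb{R}$ is operator monotone (respectively operator monotone decreasing) if, for every unital $C^*$-algebra $C$ and all self-adjoint $X,Y\in C$ with $\sigma(X),\sigma(Y)\subset(0,\infty)$ for which $h(X)$ and $h(Y)$ are defined, $X\le Y$ implies $h(X)\le h(Y)$ (respectively $h(X)\ge h(Y)$); such a function is automatically continuous. Write $A^{++}$ for the set of invertible positive elements of a unital $C^*$-algebra $A$. A linear map $\Phi\colon A\to B$ between unital $C^*$-algebras is strictly positive if $\Phi(A^{++})\subset B^{++}$. Theorem. Let $f\colon(0,\infty)\to(0,\infty)$ be operator monotone decreasing and let $g\colon(0,\infty)\to\mathbb{R}$ be operator monotone. Let $A$ and $B$ be unital $C^*$-algebras and let $\Phi\colon A\to B$ be a strictly positive linear map. Then the map $A^{++}\to B$, $X\mapsto g(\Phi(f(X)))$, is convex: for all $X,Y\in A^{++}$ and $0\le t\le 1$, $$g\bigl(\Phi(f(tX+(1-t)Y))\bigr)\le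 t\,g\bigl(\Phi(f(X))\bigr)+(1-t)\,g\bigl(\Phi(f(Y))\bigr).$$ -/

import Mathlib

universe u v

/-- A real function `f` on a set `I` of real numbers is *operator monotone* on `I` if, in every
unital C⋆-algebra `A`, `X ≤ Y` implies `f(X) ≤ f(Y)` for all self-adjoint `X`, `Y` in `A` with
spectra in `I`. Here `f(X)` is the continuous functional calculus. The function `f` is not assumed
to be continuous: the inequality is imposed for those `X`, `Y` at which the functional calculus is
defined, that is, `f` is continuous on both spectra. This includes all elements with finite
spectrum, in particular all Hermitian matrices with eigenvalues in `I`. -/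
def IsOperatorMonotoneOn (I : Set ℝ) (f : ℝ → ℝ) : Prop :=
  ∀ (A : Type u) [CStarAlgebra A] [PartialOrder A] [StarOrderedRing A] (X Y : A),
    IsSelfAdjoint X → IsSelfAdjoint Y → spectrum ℝ X ⊆ I → spectrum ℝ Y ⊆ I →
    ContinuousOn f (spectrum ℝ X) → ContinuousOn f (spectrum ℝ Y) →
    X ≤ Y → cfc f X ≤ cfc f Y

/-- A real function `f` on `I` is *operator monotone decreasing* on `I` if, in every unital
C⋆-algebra, `X ≤ Y` implies `f(X) ≥ f(Y)` for all self-adjoint `X`, `Y` with spectra in `I` (at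
which the functional calculus by `f` is defined). -/
def IsOperatorMonotoneDecreasingOn (I : Set ℝ) (f : ℝ → ℝ) : Prop :=
  ∀ (A : Type u) [CStarAlgebra A] [PartialOrder A] [StarOrderedRing A] (X Y : A),
    IsSelfAdjoint X → IsSelfAdjoint Y → spectrum ℝ X ⊆ I → spectrum ℝ Y ⊆ I →
    ContinuousOn f (spectrum ℝ X) → ContinuousOn f (spectrum ℝ Y) →
    X ≤ Y → cfc f Y ≤ cfc f X

/-- A linear map between unital C⋆-algebras is *strictly positive* if it maps invertible positive
elements to invertible positive elements. -/
def IsStrictlyPositiveMap {A : Type u} {B : Type v}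
    [CStarAlgebra A] [PartialOrder A] [CStarAlgebra B] [PartialOrder B]
    (Φ : A →ₗ[ℂ] B) : Prop :=
  ∀ X : A, IsStrictlyPositive X → IsStrictlyPositive (Φ X)

/-! For weights `a + b = 1`, the argument is the chain
`g(Φ(f(aX + bY))) ≤ g(Φ(f(X) ! f(Y))) ≤ g(Φ(f(X)) ! Φ(f(Y))) ≤ a g(Φ(f(X))) + b g(Φ(f(Y)))`,
where `P ! Q = (aP⁻¹ + bQ⁻¹)⁻¹` is the weighted harmonic mean.

The outer inequalities both say that an operator monotone function on `(0, ∞)` is operator concave,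
applied to `1 / f` and to `x ↦ -g(1 / x)`. For the concavity of `h`, rotate `diag(X, Y)` to a block
matrix with corner `Z = aX + bY`. It is dominated by `diag(Z + ε, r)` for large `r`, so comparing
corners gives `a h(X) + b h(Y) ≤ h(Z + ε)`. For scalars this already forces `h` to be continuous,
which justifies letting `ε` tend to `0`.

The middle inequality follows from Choi's inequality `Φ(H) Φ(S)⁻¹ Φ(H) ≤ Φ(H S⁻¹ H)`, which reduces
to the case `S = 1` by conjugating with `S ^ (1 / 2)`. There one writes `H = ∑ tᵢ wᵢ` with `wᵢ ≥ 0`,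
`∑ wᵢ = 1` and `∑ tᵢ² wᵢ ≤ H² + ε`, and applies a Cauchy–Schwarz inequality to the `Φ(wᵢ)`.
Bernstein polynomials in `H` provide such `wᵢ`, the excess `ε` being the binomial variance. -/

open Set Filter Topology
open scoped Ring CStarAlgebra

lemma le_of_forall_pos_le_add_smul {E : Type*} [AddCommGroup E] [Module ℝ E] [TopologicalSpace E]
    [ContinuousAdd E] [ContinuousSMul ℝ E] [Preorder E] [ClosedIciTopology E] {x y z : E}
    (h : ∀ ε : ℝ, 0 < ε → x ≤ y + ε • z) : x ≤ y := by
  have hlim : Tendsto (fun ε : ℝ => y + ε • z) (𝓝[>] 0) (𝓝 y) := by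
    have hcont : Continuous fun ε : ℝ => y + ε • z := by fun_prop
    simpa using (hcont.tendsto 0).mono_left nhdsWithin_le_nhds
  exact ge_of_tendsto hlim (eventually_mem_nhdsWithin.mono h)

section StrictlyPositive

variable {A : Type*} [CStarAlgebra A] [PartialOrder A] [StarOrderedRing A]

lemma convex_setOf_isStrictlyPositive : Convex ℝ {X : A | IsStrictlyPositive X} :=
  CStarAlgebra.convexOn_ringInverse.1

lemma isStrictlyPositive_iff_spectrum_subset {X : A} (hX : IsSelfAdjoint X) :
    IsStrictlyPositive X ↔ spectrum ℝ X ⊆ Ioi 0 :=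
  StarOrderedRing.isStrictlyPositive_iff_spectrum_pos X

end StrictlyPositive

section TwoByTwo

variable {A : Type*} [CStarAlgebra A]

namespace BlockMatrix

/-- The diagonal embedding of `A × A` into the `2 × 2` matrices over `A`. -/
def diag : A × A →⋆ₐ[ℂ] CStarMatrix (Fin 2) (Fin 2) A where
  toFun z := CStarMatrix.ofMatrix (Matrix.diagonal ![z.1, z.2])
  map_one' := by ext i j; fin_cases i <;> fin_cases j <;> simp
  map_mul' z w := by
    ext i j; fin_cases i <;> fin_cases j <;> simp [CStarMatrix.mul_apply]
  map_zero' := by ext i j; fin_cases i <;> fin_cases j <;> simp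
  map_add' z w := by ext i j; fin_cases i <;> fin_cases j <;> simp
  commutes' r := by
    ext i j; fin_cases i <;> fin_cases j <;> simp [CStarMatrix.algebraMap_apply]
  map_star' z := by ext i j; fin_cases i <;> fin_cases j <;> simp [CStarMatrix.star_apply]

/-- The rotation with cosine `c` and sine `s`, as a unitary `2 × 2` matrix over `A`. -/
noncomputable def rotation (c s : ℝ) (h : c ^ 2 + s ^ 2 = 1) :
    unitary (CStarMatrix (Fin 2) (Fin 2) A) :=
  ⟨CStarMatrix.ofMatrix
      !![algebraMap ℝ A c, -algebraMap ℝ A s; algebraMap ℝ A s, algebraMap ℝ A c], by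
    have h' : algebraMap ℝ A c ^ 2 + algebraMap ℝ A s ^ 2 = 1 := by
      rw [← map_pow, ← map_pow, ← map_add, h, map_one]
    rw [Unitary.mem_iff]
    constructor <;> ext i j <;> fin_cases i <;> fin_cases j <;>
      simp [CStarMatrix.mul_apply, CStarMatrix.star_apply, ← sq, h',
        add_comm (algebraMap ℝ A s ^ 2), ← algebraMap_star_comm,
        Algebra.commutes s (algebraMap ℝ A c)]⟩

/-- The star homomorphism `(X, Y) ↦ U * diag (X, Y) * U⁻¹` where `U` is the rotation with cosine `c`
and sine `s`. -/
noncomputable def rotatedDiag (c s : ℝ) (h : c ^ 2 + s ^ 2 = 1) :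
    A × A →⋆ₐ[ℂ] CStarMatrix (Fin 2) (Fin 2) A :=
  ((Unitary.conjStarAlgAut ℂ _ (rotation c s h) : CStarMatrix (Fin 2) (Fin 2) A ≃⋆ₐ[ℂ] _) :
    CStarMatrix (Fin 2) (Fin 2) A →⋆ₐ[ℂ] CStarMatrix (Fin 2) (Fin 2) A).comp diag

lemma rotatedDiag_apply_zero_zero (c s : ℝ) (h : c ^ 2 + s ^ 2 = 1) (X Y : A) :
    rotatedDiag c s h (X, Y) 0 0 = c ^ 2 • X + s ^ 2 • Y := by
  simp [rotatedDiag, rotation, diag, CStarMatrix.mul_apply, CStarMatrix.star_apply,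
    Algebra.algebraMap_eq_smul_one, smul_smul, sq]

variable [PartialOrder A] [StarOrderedRing A]

lemma apply_self_nonneg {n : Type*} [Fintype n] {M : CStarMatrix n n A}
    (hM : 0 ≤ M) (i : n) : 0 ≤ M i i := by
  rw [StarOrderedRing.nonneg_iff] at hM
  induction hM using AddSubmonoid.closure_induction with
  | mem _ hM =>
    obtain ⟨N, rfl⟩ := hM
    exact Finset.sum_nonneg fun j _ => star_mul_self_nonneg (N j i)
  | zero => exact le_rfl
  | add _ _ _ _ hM hN => exact add_nonneg hM hN

lemma exists_le_diag {M : CStarMatrix (Fin 2) (Fin 2) A} (hM : IsSelfAdjoint M) {ε : ℝ}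
    (hε : 0 < ε) :
    ∃ r : ℝ, M ≤ diag (M 0 0 + algebraMap ℝ A ε, algebraMap ℝ A r) := by
  have hM' (i j : Fin 2) : star (M i j) = M j i := congr_fun₂ hM.star_eq j i
  set T := M 1 1 + ε⁻¹ • (M 1 0 * M 0 1) with hT
  have hTs : IsSelfAdjoint T := by simp [T, isSelfAdjoint_iff, hM']
  have hle : T ≤ algebraMap ℝ A ‖T‖ := hTs.le_algebraMap_norm_self
  obtain ⟨q, hq⟩ := CStarAlgebra.nonneg_iff_eq_star_mul_self.mp (sub_nonneg.mpr hle)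
  refine ⟨‖T‖, sub_nonneg.mp ?_⟩
  -- Cholesky factor of the difference: the Schur complement of its `(0, 0)` entry `ε` is `‖T‖ - T`.
  let N : CStarMatrix (Fin 2) (Fin 2) A :=
    CStarMatrix.ofMatrix !![algebraMap ℝ A √ε, -((√ε)⁻¹ • M 0 1); 0, q]
  suffices diag (M 0 0 + algebraMap ℝ A ε, algebraMap ℝ A ‖T‖) - M = star N * N from
    this ▸ star_mul_self_nonneg N
  have hsq : √ε * √ε = ε := Real.mul_self_sqrt hε.le
  have hne : √ε ≠ 0 := (Real.sqrt_pos.mpr hε).ne'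
  have hN11 : algebraMap ℝ A ‖T‖ - M 1 1 = ε⁻¹ • (M 1 0 * M 0 1) + star q * q := by
    rw [sub_eq_iff_eq_add] at hq; rw [hq, hT]; abel
  ext i j
  fin_cases i <;> fin_cases j <;>
    simp [diag, N, CStarMatrix.mul_apply, CStarMatrix.star_apply, hM',
      Algebra.algebraMap_eq_smul_one, smul_smul, hsq, hne, ← mul_inv]
  simpa [Algebra.algebraMap_eq_smul_one] using hN11

end BlockMatrix
end TwoByTwo

section ProductCalculus

variable {A₁ A₂ C : Type*} [CStarAlgebra A₁] [CStarAlgebra A₂] [CStarAlgebra C]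

lemma spectrum_map_prod_subset (φ : A₁ × A₂ →⋆ₐ[ℂ] C) (X : A₁) (Y : A₂) :
    spectrum ℝ (φ (X, Y)) ⊆ spectrum ℝ X ∪ spectrum ℝ Y :=
  (AlgHom.spectrum_apply_subset (φ.restrictScalars ℝ) (X, Y)).trans (Prod.spectrum_eq X Y).le

lemma map_prod_cfc (φ : A₁ × A₂ →⋆ₐ[ℂ] C) {g : ℝ → ℝ} {X : A₁} {Y : A₂}
    (hX : IsSelfAdjoint X) (hY : IsSelfAdjoint Y) (hgX : ContinuousOn g (spectrum ℝ X))
    (hgY : ContinuousOn g (spectrum ℝ Y)) :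
    φ (cfc g X, cfc g Y) = cfc g (φ (X, Y)) := by
  have hXY : IsSelfAdjoint (X, Y) := Prod.ext hX hY
  have hg : ContinuousOn g (spectrum ℝ X ∪ spectrum ℝ Y) :=
    hgX.union_of_isClosed hgY (spectrum.isClosed X) (spectrum.isClosed Y)
  have : ContinuousFunctionalCalculus ℝ (A₁ × A₂) IsSelfAdjoint :=
    IsSelfAdjoint.instContinuousFunctionalCalculus (A := A₁ × A₂)
  rw [← cfc_map_prod (S := ℂ) g X Y hg]
  exact φ.map_cfc g (X, Y) (by rwa [Prod.spectrum_eq]) (map_continuous φ) hXY (hXY.map φ)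

lemma continuousOn_spectrum_map_prod (φ : A₁ × A₂ →⋆ₐ[ℂ] C) {g : ℝ → ℝ} {X : A₁} {Y : A₂}
    (hgX : ContinuousOn g (spectrum ℝ X)) (hgY : ContinuousOn g (spectrum ℝ Y)) :
    ContinuousOn g (spectrum ℝ (φ (X, Y))) :=
  (hgX.union_of_isClosed hgY (spectrum.isClosed X) (spectrum.isClosed Y)).mono
    (spectrum_map_prod_subset φ X Y)

lemma isStrictlyPositive_map_prod [PartialOrder A₁] [StarOrderedRing A₁] [PartialOrder A₂]
    [StarOrderedRing A₂] [PartialOrder C] [StarOrderedRing C] (φ : A₁ × A₂ →⋆ₐ[ℂ] C) {X : A₁}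
    {Y : A₂} (hX : IsStrictlyPositive X) (hY : IsStrictlyPositive Y) :
    IsStrictlyPositive (φ (X, Y)) := by
  have hXY : IsSelfAdjoint (X, Y) := Prod.ext hX.isSelfAdjoint hY.isSelfAdjoint
  exact (isStrictlyPositive_iff_spectrum_subset (hXY.map φ)).mpr
    ((spectrum_map_prod_subset φ X Y).trans
      (union_subset (fun _ => hX.spectrum_pos) fun _ => hY.spectrum_pos))

end ProductCalculus

section Concavity

lemma continuousOn_spectrum_algebraMap (A : Type*) [CStarAlgebra A] [Nontrivial A] (g : ℝ → ℝ)
    (r : ℝ) : ContinuousOn g (spectrum ℝ (algebraMap ℝ A r)) := by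
  rw [spectrum.scalar_eq]
  exact continuousOn_singleton g r

variable {A : Type u} [CStarAlgebra A] [PartialOrder A] [StarOrderedRing A] {g : ℝ → ℝ}

lemma IsOperatorMonotoneOn.cfc_le_cfc_of_continuousOn (hg : IsOperatorMonotoneOn.{u} (Ioi 0) g)
    {X Y : A} (hX : IsStrictlyPositive X) (hgX : ContinuousOn g (spectrum ℝ X))
    (hgY : ContinuousOn g (spectrum ℝ Y)) (hXY : X ≤ Y) : cfc g X ≤ cfc g Y :=
  have hY := hX.of_le hXY
  hg A X Y hX.isSelfAdjoint hY.isSelfAdjoint (fun _ => hX.spectrum_pos) (fun _ => hY.spectrum_pos)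
    hgX hgY hXY

open BlockMatrix in
lemma IsOperatorMonotoneOn.smul_cfc_add_smul_cfc_le (hg : IsOperatorMonotoneOn.{u} (Ioi 0) g)
    {X Y : A} (hX : IsStrictlyPositive X) (hY : IsStrictlyPositive Y) {a b ε : ℝ} (ha : 0 ≤ a)
    (hb : 0 ≤ b) (hab : a + b = 1) (hε : 0 < ε) (hgX : ContinuousOn g (spectrum ℝ X))
    (hgY : ContinuousOn g (spectrum ℝ Y))
    (hgZ : ContinuousOn g (spectrum ℝ (a • X + b • Y + algebraMap ℝ A ε))) :
    a • cfc g X + b • cfc g Y ≤ cfc g (a • X + b • Y + algebraMap ℝ A ε) := by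
  nontriviality A
  set Z := a • X + b • Y + algebraMap ℝ A ε
  have hZ : IsSelfAdjoint Z :=
    (((IsSelfAdjoint.all a).smul hX.isSelfAdjoint).add
      ((IsSelfAdjoint.all b).smul hY.isSelfAdjoint)).add (.algebraMap A (.all ε))
  have hcs : √a ^ 2 + √b ^ 2 = 1 := by rw [Real.sq_sqrt ha, Real.sq_sqrt hb, hab]
  have corner (P Q : A) : rotatedDiag √a √b hcs (P, Q) 0 0 = a • P + b • Q := by
    rw [rotatedDiag_apply_zero_zero, Real.sq_sqrt ha, Real.sq_sqrt hb]
  have hpos : IsStrictlyPositive (rotatedDiag √a √b hcs (X, Y)) :=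
    isStrictlyPositive_map_prod _ hX hY
  obtain ⟨r, hle⟩ := exists_le_diag hpos.isSelfAdjoint hε
  rw [corner] at hle
  have hr : IsSelfAdjoint (algebraMap ℝ A r) := .algebraMap A (.all r)
  have hgr := continuousOn_spectrum_algebraMap A g r
  have key : rotatedDiag √a √b hcs (cfc g X, cfc g Y) ≤
      diag (cfc g Z, cfc g (algebraMap ℝ A r)) := by
    rw [map_prod_cfc _ hX.isSelfAdjoint hY.isSelfAdjoint hgX hgY, map_prod_cfc _ hZ hr hgZ hgr]
    exact hg.cfc_le_cfc_of_continuousOn hpos (continuousOn_spectrum_map_prod _ hgX hgY)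
      (continuousOn_spectrum_map_prod _ hgZ hgr) hle
  have hentry := apply_self_nonneg (sub_nonneg.mpr key) 0
  rwa [CStarMatrix.sub_apply, corner, sub_nonneg] at hentry

lemma IsOperatorMonotoneOn.mul_add_mul_le_of_lt (A : Type u) [CStarAlgebra A] [PartialOrder A]
    [StarOrderedRing A] [Nontrivial A] (hg : IsOperatorMonotoneOn.{u} (Ioi 0) g)
    {x y z a b : ℝ} (hx : 0 < x) (hy : 0 < y) (ha : 0 ≤ a) (hb : 0 ≤ b) (hab : a + b = 1)
    (hz : a * x + b * y < z) : a * g x + b * g y ≤ g z := by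
  have hZ : a • algebraMap ℝ A x + b • algebraMap ℝ A y + algebraMap ℝ A (z - (a * x + b * y)) =
      algebraMap ℝ A z := by
    simp only [Algebra.algebraMap_eq_smul_one]
    module
  have key := hg.smul_cfc_add_smul_cfc_le (A := A) (isStrictlyPositive_algebraMap hx)
    (isStrictlyPositive_algebraMap hy) ha hb hab (sub_pos.mpr hz)
    (continuousOn_spectrum_algebraMap A g x) (continuousOn_spectrum_algebraMap A g y)
    (hZ ▸ continuousOn_spectrum_algebraMap A g z)
  rw [hZ, cfc_algebraMap, cfc_algebraMap, cfc_algebraMap] at key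
  rw [← algebraMap_le_algebraMap (β := A)]
  simpa [Algebra.algebraMap_eq_smul_one, add_smul, mul_smul] using key

lemma IsOperatorMonotoneOn.monotoneOn (A : Type u) [CStarAlgebra A] [PartialOrder A]
    [StarOrderedRing A] [Nontrivial A] (hg : IsOperatorMonotoneOn.{u} (Ioi 0) g) :
    MonotoneOn g (Ioi 0) := fun x hx y _ hxy => by
  have key := hg.cfc_le_cfc_of_continuousOn (isStrictlyPositive_algebraMap hx)
    (continuousOn_spectrum_algebraMap A g x) (continuousOn_spectrum_algebraMap A g y)
    (algebraMap_mono A hxy)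
  rwa [cfc_algebraMap, cfc_algebraMap, algebraMap_le_algebraMap] at key

lemma continuousOn_Ioi_of_mul_add_mul_le_of_lt (hmono : MonotoneOn g (Ioi 0))
    (hconc : ∀ x y z a b : ℝ, 0 < x → 0 < y → 0 ≤ a → 0 ≤ b → a + b = 1 → a * x + b * y < z →
      a * g x + b * g y ≤ g z) : ContinuousOn g (Ioi 0) := by
  refine fun x (hx : 0 < x) => (Metric.continuousAt_iff.mpr fun ε hε => ?_).continuousWithinAt
  set D := g (2 * x) - g (x / 2)
  have hD : 0 ≤ D := sub_nonneg.mpr (hmono (half_pos hx) (mem_Ioi.mpr (by linarith)) (by linarith))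
  obtain ⟨a, ha, ha1, haD⟩ : ∃ a, 0 < a ∧ a ≤ 1 ∧ a * D < ε :=
    ⟨ε / (D + ε), by positivity, by rw [div_le_one₀] <;> linarith, by
      rw [div_mul_eq_mul_div, div_lt_iff₀] <;> nlinarith⟩
  set δ := a * x / 4
  have hδ : 0 < δ := by positivity
  have hδa : 4 * δ = a * x := by ring
  have hδx : 4 * δ ≤ x := hδa.trans_le (mul_le_of_le_one_left hx.le ha1)
  -- `x - δ` lies just above the point dividing `[x / 2, x + δ]` in the ratio `1 - a : a`.
  have hosc : g (x + δ) - g (x - δ) < ε := by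
    have h₁ : a * g (x / 2) + (1 - a) * g (x + δ) ≤ g (x - δ) :=
      hconc _ _ _ _ _ (half_pos hx) (by linarith) ha.le (by linarith) (by ring)
        (by linarith [mul_pos ha hδ])
    have h₂ : a * (g (x + δ) - g (x / 2)) ≤ a * D := by
      gcongr
      exact sub_le_sub_right (hmono (mem_Ioi.mpr (by linarith)) (mem_Ioi.mpr (by linarith))
        (by linarith)) _
    linarith
  refine ⟨δ, hδ, fun {y} hy => ?_⟩
  rw [Real.dist_eq, abs_lt] at hy ⊢
  have hbound {z : ℝ} (h₁ : -δ < z - x) (h₂ : z - x < δ) : g (x - δ) ≤ g z ∧ g z ≤ g (x + δ) :=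
    ⟨hmono (mem_Ioi.mpr (by linarith)) (mem_Ioi.mpr (by linarith)) (by linarith),
      hmono (mem_Ioi.mpr (by linarith)) (mem_Ioi.mpr (by linarith)) (by linarith)⟩
  have hgy := hbound hy.1 hy.2
  have hgx := hbound (z := x) (by linarith) (by linarith)
  constructor <;> linarith

open scoped ComplexOrder in
lemma IsOperatorMonotoneOn.continuousOn (hg : IsOperatorMonotoneOn.{u} (Ioi 0) g) :
    ContinuousOn g (Ioi 0) :=
  continuousOn_Ioi_of_mul_add_mul_le_of_lt (hg.monotoneOn (PUnit.{u + 1} → ℂ))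
    fun _ _ _ _ _ => hg.mul_add_mul_le_of_lt (PUnit.{u + 1} → ℂ)

lemma IsOperatorMonotoneOn.continuousOn_spectrum (hg : IsOperatorMonotoneOn.{u} (Ioi 0) g)
    {X : A} (hX : IsStrictlyPositive X) : ContinuousOn g (spectrum ℝ X) :=
  hg.continuousOn.mono fun _ => hX.spectrum_pos

lemma IsOperatorMonotoneOn.cfc_le_cfc (hg : IsOperatorMonotoneOn.{u} (Ioi 0) g) {X Y : A}
    (hX : IsStrictlyPositive X) (hXY : X ≤ Y) : cfc g X ≤ cfc g Y :=
  hg.cfc_le_cfc_of_continuousOn hX (hg.continuousOn_spectrum hX)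
    (hg.continuousOn_spectrum (hX.of_le hXY)) hXY

lemma continuousOn_cfc_add_algebraMap (hg : ContinuousOn g (Ioi 0)) {X : A}
    (hX : IsStrictlyPositive X) :
    ContinuousOn (fun ε : ℝ => cfc g (X + algebraMap ℝ A ε)) (Ici 0) := by
  have hpos : ∀ ε ∈ Ici (0 : ℝ), IsStrictlyPositive (X + algebraMap ℝ A ε) := fun ε hε =>
    hX.add_nonneg (by simpa using algebraMap_mono A (mem_Ici.mp hε))
  exact ContinuousOn.cfc_of_mem_nhdsSet g (s := Ioi 0)
    (isOpen_Ioi.mem_nhdsSet.mpr (iUnion₂_subset fun ε hε _ => (hpos ε hε).spectrum_pos))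
    (by fun_prop) (fun ε hε => (hpos ε hε).isSelfAdjoint) hg

theorem IsOperatorMonotoneOn.concaveOn_cfc (hg : IsOperatorMonotoneOn.{u} (Ioi 0) g) :
    ConcaveOn ℝ {X : A | IsStrictlyPositive X} (cfc g) := by
  refine ⟨convex_setOf_isStrictlyPositive, fun X hX Y hY a b ha hb hab => ?_⟩
  have hZ : IsStrictlyPositive (a • X + b • Y) :=
    convex_setOf_isStrictlyPositive hX hY ha hb hab
  have hlim : Tendsto (fun ε : ℝ => cfc g (a • X + b • Y + algebraMap ℝ A ε)) (𝓝[>] 0)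
      (𝓝 (cfc g (a • X + b • Y))) := by
    simpa using ((continuousOn_cfc_add_algebraMap hg.continuousOn hZ 0 self_mem_Ici).mono
      Ioi_subset_Ici_self).tendsto
  refine ge_of_tendsto hlim (eventually_mem_nhdsWithin.mono fun ε (hε : 0 < ε) => ?_)
  exact hg.smul_cfc_add_smul_cfc_le hX hY ha hb hab hε (hg.continuousOn_spectrum hX)
    (hg.continuousOn_spectrum hY)
    (hg.continuousOn_spectrum (hZ.add_nonneg (isStrictlyPositive_algebraMap hε).nonneg))

end Concavity

section Kadison

lemma sum_smul_mul_ringInverse_mul_sum_smul_le {ι B : Type*} [Ring B] [StarRing B] [PartialOrder B]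
    [StarOrderedRing B] [Algebra ℝ B] [StarModule ℝ B] {s : Finset ι} {w : ι → B}
    (hw : ∀ i ∈ s, 0 ≤ w i) (hu : IsUnit (∑ i ∈ s, w i)) (t : ι → ℝ) :
    (∑ i ∈ s, t i • w i) * (∑ i ∈ s, w i)⁻¹ʳ * (∑ i ∈ s, t i • w i) ≤
      ∑ i ∈ s, t i ^ 2 • w i := by
  set S := ∑ i ∈ s, w i with hS
  set T := ∑ i ∈ s, t i • w i with hT
  have hSinv : IsSelfAdjoint S⁻¹ʳ := (IsSelfAdjoint.of_nonneg (Finset.sum_nonneg hw)).ringInverse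
  have hTs : IsSelfAdjoint T := sum_mem (S := selfAdjoint B) fun i hi =>
    (IsSelfAdjoint.all (t i)).smul (.of_nonneg (hw i hi))
  have hM : star (S⁻¹ʳ * T) = T * S⁻¹ʳ := by
    rw [star_mul, hTs.star_eq, hSinv.star_eq]
  rw [← sub_nonneg]
  calc 0 ≤ ∑ i ∈ s, star (t i • 1 - S⁻¹ʳ * T) * w i * (t i • 1 - S⁻¹ʳ * T) :=
        Finset.sum_nonneg fun i hi => star_left_conjugate_nonneg (hw i hi) _
    _ = ∑ i ∈ s, (t i ^ 2 • w i - T * S⁻¹ʳ * (t i • w i) - (t i • w i) * (S⁻¹ʳ * T)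
          + T * S⁻¹ʳ * w i * (S⁻¹ʳ * T)) := by
        refine Finset.sum_congr rfl fun i _ => ?_
        simp only [star_sub, hM, star_smul, star_one, star_trivial, sub_mul, mul_sub,
          smul_mul_assoc, mul_smul_comm, one_mul, mul_one, smul_sub, sq, mul_smul]
        abel
    _ = ∑ i ∈ s, t i ^ 2 • w i - T * S⁻¹ʳ * T := by
        rw [Finset.sum_add_distrib, Finset.sum_sub_distrib, Finset.sum_sub_distrib,
          ← Finset.mul_sum, ← Finset.sum_mul, ← Finset.sum_mul, ← Finset.mul_sum, ← hT, ← hS,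
          Ring.inverse_mul_cancel_right _ _ hu, mul_assoc]
        abel

lemma sum_sq_smul_bernsteinPolynomial (R : Type*) [CommRing R] (n : ℕ) :
    ∑ k ∈ Finset.range (n + 1), k ^ 2 • bernsteinPolynomial R n k =
      n ^ 2 • Polynomial.X ^ 2 + n • (Polynomial.X - Polynomial.X ^ 2) := by
  have hsq (k : ℕ) : k ^ 2 = k * (k - 1) + k := by
    cases k
    · rfl
    · rw [Nat.add_sub_cancel]; ring
  simp_rw [hsq, add_smul, Finset.sum_add_distrib, bernsteinPolynomial.sum_mul_smul,
    bernsteinPolynomial.sum_smul, smul_sub]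
  abel

variable {A : Type*} [CStarAlgebra A] [PartialOrder A] [StarOrderedRing A]

lemma aeval_bernsteinPolynomial_nonneg {W : A} (hW₀ : 0 ≤ W) (hW₁ : W ≤ 1) (n k : ℕ) :
    0 ≤ Polynomial.aeval W (bernsteinPolynomial ℝ n k) := by
  rw [← cfc_polynomial _ W]
  refine cfc_nonneg fun x hx => ?_
  have hx₀ : 0 ≤ x := spectrum_nonneg_of_nonneg hW₀ hx
  have hx₁ : 0 ≤ 1 - x := sub_nonneg.mpr <|
    (le_algebraMap_iff_spectrum_le (R := ℝ) (r := 1) (a := W)).mp (by simpa using hW₁) x hx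
  simp only [bernsteinPolynomial, Polynomial.eval_mul, Polynomial.eval_pow, Polynomial.eval_sub,
    Polynomial.eval_X, Polynomial.eval_one, Polynomial.eval_natCast]
  positivity

lemma exists_approx_resolution_of_le_one {W : A} (hW₀ : 0 ≤ W) (hW₁ : W ≤ 1) {ε : ℝ}
    (hε : 0 < ε) :
    ∃ (n : ℕ) (w : ℕ → A) (t : ℕ → ℝ), (∀ k, 0 ≤ w k) ∧ ∑ k ∈ Finset.range n, w k = 1 ∧
      ∑ k ∈ Finset.range n, t k • w k = W ∧
      ∑ k ∈ Finset.range n, t k ^ 2 • w k ≤ W ^ 2 + ε • 1 := by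
  obtain ⟨m, hm⟩ := exists_nat_one_div_lt hε
  set n := m + 1
  have hn : (n : ℝ) ≠ 0 := by positivity
  set w := fun k => Polynomial.aeval W (bernsteinPolynomial ℝ n k)
  have hsum : ∑ k ∈ Finset.range (n + 1), w k = 1 := by
    simpa using congrArg (Polynomial.aeval W) (bernsteinPolynomial.sum ℝ n)
  have hsum_smul : ∑ k ∈ Finset.range (n + 1), (k : ℝ) • w k = (n : ℝ) • W := by
    simpa [Nat.cast_smul_eq_nsmul] using
      congrArg (Polynomial.aeval W) (bernsteinPolynomial.sum_smul ℝ n)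
  have hsum_sq : ∑ k ∈ Finset.range (n + 1), (k : ℝ) ^ 2 • w k =
      (n : ℝ) ^ 2 • W ^ 2 + (n : ℝ) • (W - W ^ 2) := by
    simp only [← Nat.cast_pow, Nat.cast_smul_eq_nsmul]
    simpa using congrArg (Polynomial.aeval W) (sum_sq_smul_bernsteinPolynomial ℝ n)
  refine ⟨n + 1, w, fun k => k / n, aeval_bernsteinPolynomial_nonneg hW₀ hW₁ n, hsum, ?_, ?_⟩
  · simp only [div_eq_inv_mul, mul_smul, ← Finset.smul_sum, hsum_smul, inv_smul_smul₀ hn]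
  · have hle : W - W ^ 2 ≤ 1 :=
      (sub_le_self W (IsSelfAdjoint.of_nonneg hW₀).sq_nonneg).trans hW₁
    calc ∑ k ∈ Finset.range (n + 1), ((k : ℝ) / n) ^ 2 • w k
        = W ^ 2 + (1 / (n : ℝ)) • (W - W ^ 2) := by
          simp only [div_eq_inv_mul, mul_pow, mul_smul, ← Finset.smul_sum, hsum_sq]
          match_scalars <;> field_simp
      _ ≤ W ^ 2 + (1 / (n : ℝ)) • 1 := by gcongr
      _ ≤ W ^ 2 + ε • 1 := by
          gcongr
          exact_mod_cast hm.le

lemma exists_approx_resolution {Z : A} (hZ : IsSelfAdjoint Z) {ε : ℝ} (hε : 0 < ε) :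
    ∃ (n : ℕ) (w : ℕ → A) (t : ℕ → ℝ), (∀ k, 0 ≤ w k) ∧ ∑ k ∈ Finset.range n, w k = 1 ∧
      ∑ k ∈ Finset.range n, t k • w k = Z ∧
      ∑ k ∈ Finset.range n, t k ^ 2 • w k ≤ Z ^ 2 + ε • 1 := by
  set R := ‖Z‖ + 1
  have hR : 0 < R := by positivity
  have hZR : Z ≤ R • 1 ∧ -Z ≤ R • 1 := by
    have hle {Y : A} (hY : IsSelfAdjoint Y) (hYR : ‖Y‖ ≤ R) : Y ≤ R • 1 := by
      rw [← Algebra.algebraMap_eq_smul_one]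
      exact hY.le_algebraMap_norm_self.trans (algebraMap_mono A hYR)
    exact ⟨hle hZ (by simp [R]), hle hZ.neg (by simp [R])⟩
  set W := (2 * R)⁻¹ • (Z + R • 1)
  have hW₀ : 0 ≤ W := smul_nonneg (by positivity) (neg_le_iff_add_nonneg'.mp hZR.2)
  have hW₁ : W ≤ 1 := by
    calc W ≤ (2 * R)⁻¹ • (R • 1 + R • 1) :=
          smul_le_smul_of_nonneg_left (add_le_add_left hZR.1 _) (by positivity)
      _ = 1 := by match_scalars; field_simp; norm_num
  have hZW : Z = (2 * R) • W - R • 1 := by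
    rw [smul_inv_smul₀ (by positivity), add_sub_cancel_right]
  obtain ⟨n, w, t, hw, hsum, hsum_smul, hsum_sq⟩ :=
    exists_approx_resolution_of_le_one hW₀ hW₁ (show 0 < ε / (2 * R) ^ 2 by positivity)
  refine ⟨n, w, fun k => 2 * R * t k - R, hw, hsum, ?_, ?_⟩
  · simp only [sub_smul, mul_smul, Finset.sum_sub_distrib, ← Finset.smul_sum, hsum, hsum_smul, hZW]
  · have hexp (k : ℕ) : (2 * R * t k - R) ^ 2 • w k =
        (2 * R) ^ 2 • t k ^ 2 • w k - (4 * R ^ 2) • t k • w k + R ^ 2 • w k := by module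
    simp only [hexp, Finset.sum_add_distrib, Finset.sum_sub_distrib, ← Finset.smul_sum, hsum,
      hsum_smul]
    calc (2 * R) ^ 2 • ∑ k ∈ Finset.range n, t k ^ 2 • w k - (4 * R ^ 2) • W + R ^ 2 • (1 : A)
        ≤ (2 * R) ^ 2 • (W ^ 2 + (ε / (2 * R) ^ 2) • 1) - (4 * R ^ 2) • W + R ^ 2 • (1 : A) := by
          gcongr
      _ = Z ^ 2 + ε • 1 := by
          rw [hZW]
          simp only [sq ((2 * R) • W - R • 1 : A), sub_mul, mul_sub, smul_mul_assoc,
            mul_smul_comm, one_mul, mul_one, ← sq W]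
          match_scalars <;> field_simp <;> ring

variable {B : Type*} [CStarAlgebra B] [PartialOrder B] [StarOrderedRing B]

lemma map_mul_ringInverse_mul_map_le_map_sq (Ψ : A →ₚ[ℝ] B) (hΨ : IsUnit (Ψ 1))
    {Z : A} (hZ : IsSelfAdjoint Z) : Ψ Z * (Ψ 1)⁻¹ʳ * Ψ Z ≤ Ψ (Z ^ 2) := by
  refine le_of_forall_pos_le_add_smul (z := Ψ 1) fun ε hε => ?_
  obtain ⟨n, w, t, hw, hsum, hsum_smul, hsum_sq⟩ := exists_approx_resolution hZ hε
  have hΨsum : ∑ k ∈ Finset.range n, Ψ (w k) = Ψ 1 := by rw [← map_sum, hsum]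
  have hΨsmul : ∑ k ∈ Finset.range n, t k • Ψ (w k) = Ψ Z := by
    simp only [← map_smul, ← map_sum, hsum_smul]
  calc Ψ Z * (Ψ 1)⁻¹ʳ * Ψ Z ≤ ∑ k ∈ Finset.range n, t k ^ 2 • Ψ (w k) := by
        have key := sum_smul_mul_ringInverse_mul_sum_smul_le (s := Finset.range n)
          (fun k _ => map_nonneg Ψ (hw k)) (hΨsum ▸ hΨ) t
        rwa [hΨsum, hΨsmul] at key
    _ = Ψ (∑ k ∈ Finset.range n, t k ^ 2 • w k) := by simp only [map_sum, map_smul]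
    _ ≤ Ψ (Z ^ 2 + ε • 1) := OrderHomClass.mono Ψ hsum_sq
    _ = Ψ (Z ^ 2) + ε • Ψ 1 := by rw [map_add, map_smul]

lemma conjSqrt_conjSqrt_ringInverse_mul_conjSqrt_ringInverse {c : A} (hc : IsStrictlyPositive c)
    (a b : A) :
    CFC.conjSqrt c (CFC.conjSqrt c⁻¹ʳ a * CFC.conjSqrt c⁻¹ʳ b) = a * c⁻¹ʳ * b := by
  have hsq : CFC.sqrt c⁻¹ʳ * CFC.sqrt c⁻¹ʳ = c⁻¹ʳ :=
    CFC.sqrt_mul_sqrt_self _ hc.ringInverse.nonneg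
  calc CFC.conjSqrt c (CFC.conjSqrt c⁻¹ʳ a * CFC.conjSqrt c⁻¹ʳ b)
      = CFC.conjSqrt c (CFC.conjSqrt c⁻¹ʳ (a * (CFC.sqrt c⁻¹ʳ * CFC.sqrt c⁻¹ʳ) * b)) := by
        simp only [CFC.conjSqrt_apply, mul_assoc]
    _ = a * c⁻¹ʳ * b := by rw [hsq, CFC.conjSqrt_conjSqrt_ringInverse c]

theorem map_mul_ringInverse_mul_map_le (Φ : A →ₚ[ℝ] B) {H S : A} (hH : IsSelfAdjoint H)
    (hS : IsStrictlyPositive S) (hΦS : IsUnit (Φ S)) :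
    Φ H * (Φ S)⁻¹ʳ * Φ H ≤ Φ (H * S⁻¹ʳ * H) := by
  let Ψ : A →ₚ[ℝ] B := Φ.comp ⟨(CFC.conjSqrt S).toLinearMap, CFC.conjSqrt_monotone⟩
  have hΨ (x : A) : Ψ x = Φ (CFC.conjSqrt S x) := rfl
  have hΨ_one : Ψ 1 = Φ S := by rw [hΨ, CFC.conjSqrt_one S hS.nonneg]
  have hZ : IsSelfAdjoint (CFC.conjSqrt S⁻¹ʳ H) :=
    hH.conjugate_self (CFC.sqrt_nonneg _).isSelfAdjoint
  have key := map_mul_ringInverse_mul_map_le_map_sq Ψ (hΨ_one ▸ hΦS) hZ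
  rwa [hΨ_one, hΨ, hΨ, sq, CFC.conjSqrt_conjSqrt_ringInverse S,
    conjSqrt_conjSqrt_ringInverse_mul_conjSqrt_ringInverse hS] at key

end Kadison

section HarmonicMean

variable {A : Type u} [CStarAlgebra A] [PartialOrder A] [StarOrderedRing A]

lemma IsStrictlyPositiveMap.map_nonneg {B : Type v} [CStarAlgebra B] [PartialOrder B]
    [StarOrderedRing B] {Φ : A →ₗ[ℂ] B} (hΦ : IsStrictlyPositiveMap Φ) {x : A} (hx : 0 ≤ x) :
    0 ≤ Φ x := by
  refine le_of_forall_pos_le_add_smul (z := Φ 1) fun ε hε => ?_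
  have hpos := hΦ (x + ε • 1) ((isStrictlyPositive_one.smul hε).nonneg_add hx)
  rw [map_add, Φ.map_smul_of_tower] at hpos
  exact hpos.nonneg

/-- A strictly positive map, bundled as a positive real-linear map. -/
noncomputable def IsStrictlyPositiveMap.toPositiveLinearMap {B : Type v} [CStarAlgebra B]
    [PartialOrder B] [StarOrderedRing B] {Φ : A →ₗ[ℂ] B} (hΦ : IsStrictlyPositiveMap Φ) :
    A →ₚ[ℝ] B :=
  .mk₀ (Φ.restrictScalars ℝ) fun _ => hΦ.map_nonneg

/-- The harmonic mean of `P` and `Q` with weights `a` and `b`, meant for strictly positive `P`, `Q`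
and nonnegative `a`, `b` with `a + b = 1`, where all the inverses are genuine. -/
noncomputable def weightedHarmonicMean {A : Type*} [Ring A] [Module ℝ A] (a b : ℝ) (P Q : A) : A :=
  (a • P⁻¹ʳ + b • Q⁻¹ʳ)⁻¹ʳ

lemma isStrictlyPositive_smul_ringInverse_add_smul_ringInverse {P Q : A}
    (hP : IsStrictlyPositive P) (hQ : IsStrictlyPositive Q) {a b : ℝ} (ha : 0 ≤ a) (hb : 0 ≤ b)
    (hab : a + b = 1) : IsStrictlyPositive (a • P⁻¹ʳ + b • Q⁻¹ʳ) :=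
  convex_setOf_isStrictlyPositive hP.ringInverse hQ.ringInverse ha hb hab

lemma le_ringInverse_of_mul_mul_le {D K : A} (hK : IsStrictlyPositive K) (h : K * D * K ≤ K) :
    D ≤ K⁻¹ʳ := by
  have key := hK.ringInverse.isSelfAdjoint.conjugate_le_conjugate h
  rwa [Ring.inverse_mul_cancel _ hK.isUnit, one_mul, ← mul_assoc,
    Ring.mul_inverse_cancel_right _ _ hK.isUnit, ← mul_assoc,
    Ring.inverse_mul_cancel _ hK.isUnit, one_mul] at key

lemma IsStrictlyPositiveMap.map_weightedHarmonicMean_le {B : Type v} [CStarAlgebra B]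
    [PartialOrder B] [StarOrderedRing B] {Φ : A →ₗ[ℂ] B} (hΦ : IsStrictlyPositiveMap Φ) {P Q : A}
    (hP : IsStrictlyPositive P) (hQ : IsStrictlyPositive Q) {a b : ℝ} (ha : 0 ≤ a) (hb : 0 ≤ b)
    (hab : a + b = 1) :
    Φ (weightedHarmonicMean a b P Q) ≤ weightedHarmonicMean a b (Φ P) (Φ Q) := by
  have hN := isStrictlyPositive_smul_ringInverse_add_smul_ringInverse hP hQ ha hb hab
  have hD := isStrictlyPositive_smul_ringInverse_add_smul_ringInverse (hΦ P hP) (hΦ Q hQ) ha hb hab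
  set H := weightedHarmonicMean a b P Q
  have hH : IsStrictlyPositive H := hN.ringInverse
  have hHNH : H * (a • P⁻¹ʳ + b • Q⁻¹ʳ) * H = H := by
    rw [show H * (a • P⁻¹ʳ + b • Q⁻¹ʳ) = 1 from Ring.inverse_mul_cancel _ hN.isUnit, one_mul]
  have hchoi {S : A} (hS : IsStrictlyPositive S) :
      Φ H * (Φ S)⁻¹ʳ * Φ H ≤ Φ (H * S⁻¹ʳ * H) :=
    map_mul_ringInverse_mul_map_le hΦ.toPositiveLinearMap hH.isSelfAdjoint hS (hΦ S hS).isUnit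
  have hle : Φ H * (a • (Φ P)⁻¹ʳ + b • (Φ Q)⁻¹ʳ) * Φ H ≤ Φ H := by
    calc Φ H * (a • (Φ P)⁻¹ʳ + b • (Φ Q)⁻¹ʳ) * Φ H
        = a • (Φ H * (Φ P)⁻¹ʳ * Φ H) + b • (Φ H * (Φ Q)⁻¹ʳ * Φ H) := by
          simp only [mul_add, add_mul, mul_smul_comm, smul_mul_assoc]
      _ ≤ a • Φ (H * P⁻¹ʳ * H) + b • Φ (H * Q⁻¹ʳ * H) := by
          gcongr
          exacts [hchoi hP, hchoi hQ]
      _ = Φ (H * (a • P⁻¹ʳ + b • Q⁻¹ʳ) * H) := by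
          simp only [mul_add, add_mul, mul_smul_comm, smul_mul_assoc, map_add,
            Φ.map_smul_of_tower]
      _ = Φ H := by rw [hHNH]
  calc Φ H = (Φ H)⁻¹ʳ⁻¹ʳ := (Ring.inverse_inverse (hΦ H hH).isUnit).symm
    _ ≤ weightedHarmonicMean a b (Φ P) (Φ Q) :=
      CStarAlgebra.ringInverse_le_ringInverse (le_ringInverse_of_mul_mul_le (hΦ H hH) hle) hD

end HarmonicMean

section OperatorMonotone

variable {A : Type u} [CStarAlgebra A] [PartialOrder A] [StarOrderedRing A] {f g : ℝ → ℝ}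

lemma isStrictlyPositive_cfc_of_pos {X : A} (hX : IsStrictlyPositive X)
    (hf_pos : ∀ x ∈ Ioi (0 : ℝ), f x ∈ Ioi (0 : ℝ)) (hf : ContinuousOn f (spectrum ℝ X)) :
    IsStrictlyPositive (cfc f X) :=
  (cfc_isStrictlyPositive_iff f X hf hX.isSelfAdjoint).mpr fun x hx => hf_pos x (hX.spectrum_pos hx)

lemma continuousOn_inv_iff_of_pos {s : Set ℝ} (hf_pos : ∀ x ∈ s, 0 < f x) :
    ContinuousOn (fun x => (f x)⁻¹) s ↔ ContinuousOn f s := by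
  refine ⟨fun h => ?_, fun h => h.inv₀ fun x hx => (hf_pos x hx).ne'⟩
  simpa [Pi.inv_def] using h.inv₀ fun x hx => (inv_pos.mpr (hf_pos x hx)).ne'

lemma IsOperatorMonotoneDecreasingOn.inv (hf : IsOperatorMonotoneDecreasingOn.{u} (Ioi 0) f)
    (hf_pos : ∀ x ∈ Ioi (0 : ℝ), f x ∈ Ioi (0 : ℝ)) :
    IsOperatorMonotoneOn.{u} (Ioi 0) (fun x => (f x)⁻¹) := by
  intro C _ _ _ X Y hX hY hXI hYI hfX hfY hXY
  have hfX' := (continuousOn_inv_iff_of_pos fun x hx => hf_pos x (hXI hx)).mp hfX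
  have hfY' := (continuousOn_inv_iff_of_pos fun x hx => hf_pos x (hYI hx)).mp hfY
  have hfY_pos : IsStrictlyPositive (cfc f Y) :=
    isStrictlyPositive_cfc_of_pos ((isStrictlyPositive_iff_spectrum_subset hY).mpr hYI) hf_pos hfY'
  rw [cfc_inv f X (fun x hx => (hf_pos x (hXI hx)).ne') hfX' hX,
    cfc_inv f Y (fun x hx => (hf_pos x (hYI hx)).ne') hfY' hY]
  exact CStarAlgebra.ringInverse_le_ringInverse (hf C X Y hX hY hXI hYI hfX' hfY' hXY) hfY_pos

lemma IsOperatorMonotoneDecreasingOn.continuousOn_spectrum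
    (hf : IsOperatorMonotoneDecreasingOn.{u} (Ioi 0) f)
    (hf_pos : ∀ x ∈ Ioi (0 : ℝ), f x ∈ Ioi (0 : ℝ)) {X : A} (hX : IsStrictlyPositive X) :
    ContinuousOn f (spectrum ℝ X) :=
  (continuousOn_inv_iff_of_pos fun x hx => hf_pos x (hX.spectrum_pos hx)).mp
    ((hf.inv hf_pos).continuousOn_spectrum hX)

lemma IsOperatorMonotoneDecreasingOn.isStrictlyPositive_cfc
    (hf : IsOperatorMonotoneDecreasingOn.{u} (Ioi 0) f)
    (hf_pos : ∀ x ∈ Ioi (0 : ℝ), f x ∈ Ioi (0 : ℝ)) {X : A} (hX : IsStrictlyPositive X) :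
    IsStrictlyPositive (cfc f X) :=
  isStrictlyPositive_cfc_of_pos hX hf_pos (hf.continuousOn_spectrum hf_pos hX)

lemma IsOperatorMonotoneDecreasingOn.cfc_inv (hf : IsOperatorMonotoneDecreasingOn.{u} (Ioi 0) f)
    (hf_pos : ∀ x ∈ Ioi (0 : ℝ), f x ∈ Ioi (0 : ℝ)) {X : A} (hX : IsStrictlyPositive X) :
    cfc (fun x => (f x)⁻¹) X = (cfc f X)⁻¹ʳ :=
  _root_.cfc_inv f X (fun x hx => (hf_pos x (hX.spectrum_pos hx)).ne')
    (hf.continuousOn_spectrum hf_pos hX) hX.isSelfAdjoint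

lemma IsOperatorMonotoneDecreasingOn.cfc_le_weightedHarmonicMean
    (hf : IsOperatorMonotoneDecreasingOn.{u} (Ioi 0) f)
    (hf_pos : ∀ x ∈ Ioi (0 : ℝ), f x ∈ Ioi (0 : ℝ)) {X Y : A} (hX : IsStrictlyPositive X)
    (hY : IsStrictlyPositive Y) {a b : ℝ} (ha : 0 ≤ a) (hb : 0 ≤ b) (hab : a + b = 1) :
    cfc f (a • X + b • Y) ≤ weightedHarmonicMean a b (cfc f X) (cfc f Y) := by
  have hZ : IsStrictlyPositive (a • X + b • Y) :=
    convex_setOf_isStrictlyPositive hX hY ha hb hab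
  have hconc : a • (cfc f X)⁻¹ʳ + b • (cfc f Y)⁻¹ʳ ≤ (cfc f (a • X + b • Y))⁻¹ʳ := by
    simpa only [hf.cfc_inv hf_pos hX, hf.cfc_inv hf_pos hY, hf.cfc_inv hf_pos hZ] using
      (hf.inv hf_pos).concaveOn_cfc.2 hX hY ha hb hab
  calc cfc f (a • X + b • Y) = (cfc f (a • X + b • Y))⁻¹ʳ⁻¹ʳ :=
        (Ring.inverse_inverse (hf.isStrictlyPositive_cfc hf_pos hZ).isUnit).symm
    _ ≤ weightedHarmonicMean a b (cfc f X) (cfc f Y) :=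
        CStarAlgebra.ringInverse_le_ringInverse hconc
          (isStrictlyPositive_smul_ringInverse_add_smul_ringInverse
            (hf.isStrictlyPositive_cfc hf_pos hX) (hf.isStrictlyPositive_cfc hf_pos hY) ha hb hab)

lemma cfc_neg_comp_inv (hg : ContinuousOn g (Ioi 0)) {X : A} (hX : IsStrictlyPositive X) :
    cfc (fun x => -g x⁻¹) X = -cfc g X⁻¹ʳ := by
  have hinv : ContinuousOn (fun x : ℝ => x⁻¹) (spectrum ℝ X) :=
    continuousOn_id.inv₀ fun x hx => (hX.spectrum_pos hx).ne'
  have himage : (fun x : ℝ => x⁻¹) '' spectrum ℝ X ⊆ Ioi 0 :=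
    image_subset_iff.mpr fun x hx => inv_pos.mpr (hX.spectrum_pos hx)
  rw [cfc_neg, cfc_comp' g (fun x => x⁻¹) X (hg.mono himage) hinv hX.isSelfAdjoint,
    cfc_ringInverse_id (R := ℝ) X hX.isUnit hX.isSelfAdjoint]

lemma IsOperatorMonotoneOn.neg_comp_inv (hg : IsOperatorMonotoneOn.{u} (Ioi 0) g) :
    IsOperatorMonotoneOn.{u} (Ioi 0) (fun x => -g x⁻¹) := by
  intro C _ _ _ X Y hX _ hXI _ _ _ hXY
  have hX_pos : IsStrictlyPositive X := (isStrictlyPositive_iff_spectrum_subset hX).mpr hXI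
  have hY_pos : IsStrictlyPositive Y := hX_pos.of_le hXY
  rw [cfc_neg_comp_inv hg.continuousOn hX_pos, cfc_neg_comp_inv hg.continuousOn hY_pos,
    neg_le_neg_iff]
  exact hg.cfc_le_cfc hY_pos.ringInverse (CStarAlgebra.ringInverse_le_ringInverse hXY hX_pos)

lemma IsOperatorMonotoneOn.cfc_weightedHarmonicMean_le (hg : IsOperatorMonotoneOn.{u} (Ioi 0) g)
    {P Q : A} (hP : IsStrictlyPositive P) (hQ : IsStrictlyPositive Q) {a b : ℝ} (ha : 0 ≤ a)
    (hb : 0 ≤ b) (hab : a + b = 1) :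
    cfc g (weightedHarmonicMean a b P Q) ≤ a • cfc g P + b • cfc g Q := by
  have hN := isStrictlyPositive_smul_ringInverse_add_smul_ringInverse hP hQ ha hb hab
  have hconc := hg.neg_comp_inv.concaveOn_cfc.2 hP.ringInverse hQ.ringInverse ha hb hab
  rw [cfc_neg_comp_inv hg.continuousOn hP.ringInverse,
    cfc_neg_comp_inv hg.continuousOn hQ.ringInverse, cfc_neg_comp_inv hg.continuousOn hN,
    Ring.inverse_inverse hP.isUnit, Ring.inverse_inverse hQ.isUnit, smul_neg, smul_neg,
    ← neg_add] at hconc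
  exact neg_le_neg_iff.mp hconc

end OperatorMonotone

theorem theorem3p1
    {A : Type u} {B : Type v}
    [CStarAlgebra A] [PartialOrder A] [StarOrderedRing A]
    [CStarAlgebra B] [PartialOrder B] [StarOrderedRing B]
    (f g : ℝ → ℝ)
    (hf_pos : ∀ x ∈ Set.Ioi (0 : ℝ), f x ∈ Set.Ioi (0 : ℝ))
    (hf : IsOperatorMonotoneDecreasingOn.{u} (Set.Ioi 0) f)
    (hg : IsOperatorMonotoneOn.{v} (Set.Ioi 0) g)
    (Φ : A →ₗ[ℂ] B) (hΦ : IsStrictlyPositiveMap Φ) :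
    ConvexOn ℝ {X : A | IsStrictlyPositive X} (fun X : A => cfc g (Φ (cfc f X))) := by
  refine ⟨convex_setOf_isStrictlyPositive, fun X hX Y hY a b ha hb hab => ?_⟩
  have hf_cfc {Z : A} (hZ : IsStrictlyPositive Z) : IsStrictlyPositive (cfc f Z) :=
    hf.isStrictlyPositive_cfc hf_pos hZ
  have hΦf_le : Φ (cfc f (a • X + b • Y)) ≤
      weightedHarmonicMean a b (Φ (cfc f X)) (Φ (cfc f Y)) :=
    calc Φ (cfc f (a • X + b • Y)) ≤ Φ (weightedHarmonicMean a b (cfc f X) (cfc f Y)) :=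
          hΦ.toPositiveLinearMap.monotone'
            (hf.cfc_le_weightedHarmonicMean hf_pos hX hY ha hb hab)
      _ ≤ weightedHarmonicMean a b (Φ (cfc f X)) (Φ (cfc f Y)) :=
          hΦ.map_weightedHarmonicMean_le (hf_cfc hX) (hf_cfc hY) ha hb hab
  calc cfc g (Φ (cfc f (a • X + b • Y)))
      ≤ cfc g (weightedHarmonicMean a b (Φ (cfc f X)) (Φ (cfc f Y))) :=
        hg.cfc_le_cfc (hΦ _ (hf_cfc (convex_setOf_isStrictlyPositive hX hY ha hb hab))) hΦf_le
    _ ≤ a • cfc g (Φ (cfc f X)) + b • cfc g (Φ (cfc f Y)) :=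
        hg.cfc_weightedHarmonicMean_le (hΦ _ (hf_cfc hX)) (hΦ _ (hf_cfc hY)) ha hb hab
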